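/- Let $\mathbb{K}\in\{\mathbb{R},\mathbb{C}\}$, let $H$ and $K$ be Hilbert spaces over $\mathbb{K}$, and let $T$ be a densely defined closed linear operator from $D(T)\subseteq H$ into $K$ whose range $R(T)$ is closed. For a closed operator $S$ from $D(S)$, a subspace of a Hilbert space $X$, into a Hilbert space $Y$, with null space $N(S)$, let $S^{\dagger}$ denote its Moore–Penrose inverse: the operator with domain $R(S)\oplus R(S)^{\perp}$ that equals $\big(S|_{D(S)\cap N(S)^{\perp}}\big)^{-1}$ on $R(S)$ and $0$ on $R(S)^{\perp}$. For a densely defined closed operator $S$ let $|S|=(S^{*}S)^{1/2}$ be its modulus, that is, the unique non-negative self-adjoint operator $A$ with $A^2=S^{*}S$, and let $w(S)=S(S^{*}S)^{\dagger}$ be its generalized Cauchy dual. Products of operators carry their natural domains, and equality of operators includes equality of domains. Then $$|w(T)| = w(|T|) = |T|^{\dagger}.$$ -/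

import Mathlib

/-! # Moore-Penrose inverse, modulus and generalized Cauchy dual of unbounded operators

An operator from a Hilbert space `H` to a Hilbert space `K` is a linear map defined on a subspace
of `H`, that is, a term of `H →ₗ.[𝕜] K`. Equality of such terms means equality of the domains and
of the values. -/

noncomputable section

namespace UnboundedOp

section Comp

variable {𝕜 E F G : Type*} [RCLike 𝕜]
  [AddCommGroup E] [Module 𝕜 E] [AddCommGroup F] [Module 𝕜 F] [AddCommGroup G] [Module 𝕜 G]

/-- The subspace `{x ∈ D(T) | T x ∈ D(S)}`. -/
def compDomain (S : F →ₗ.[𝕜] G) (T : E →ₗ.[𝕜] F) : Submodule 𝕜 E :=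
  (S.domain.comap T.toFun).map T.domain.subtype

theorem domRestrict_compDomain_mem (S : F →ₗ.[𝕜] G) (T : E →ₗ.[𝕜] F)
    (x : (T.domRestrict (compDomain S T)).domain) :
    T.domRestrict (compDomain S T) x ∈ S.domain := by
  obtain ⟨u, hu, hux⟩ := x.2.1
  have h : T.domRestrict (compDomain S T) x = T u := LinearPMap.domRestrict_apply hux.symm
  rw [h]
  exact hu

/-- The product `S T` of two operators, with its natural domain `{x ∈ D(T) | T x ∈ D(S)}`. -/
def comp (S : F →ₗ.[𝕜] G) (T : E →ₗ.[𝕜] F) : E →ₗ.[𝕜] G :=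
  S.comp (T.domRestrict (compDomain S T)) (domRestrict_compDomain_mem S T)

theorem mem_graph_comp (S : F →ₗ.[𝕜] G) (T : E →ₗ.[𝕜] F) (x : E) (z : G) :
    (x, z) ∈ (comp S T).graph ↔ ∃ y, (x, y) ∈ T.graph ∧ (y, z) ∈ S.graph := by
  simp only [LinearPMap.mem_graph_iff]
  constructor
  · rintro ⟨⟨v, hv⟩, rfl, rfl⟩
    obtain ⟨⟨u, hu, hux⟩, hx⟩ := id hv
    refine ⟨_, ⟨u, hux, rfl⟩, ⟨⟨T u, hu⟩, rfl, ?_⟩⟩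
    change _ = S ⟨T.domRestrict (compDomain S T) ⟨v, hv⟩, _⟩
    congr 1
    exact Subtype.ext (LinearPMap.domRestrict_apply (y := u) hux.symm).symm
  · rintro ⟨_, ⟨u, rfl, rfl⟩, ⟨w, hw, rfl⟩⟩
    have hu : T u ∈ S.domain := hw ▸ w.2
    have hv : (u : E) ∈ (comp S T).domain := ⟨⟨u, hu, rfl⟩, u.2⟩
    refine ⟨⟨u, hv⟩, rfl, ?_⟩
    change S ⟨T.domRestrict (compDomain S T) ⟨u, hv⟩, _⟩ = _
    congr 1
    exact Subtype.ext ((LinearPMap.domRestrict_apply (y := u) rfl).trans hw.symm)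

end Comp

variable {𝕜 H K : Type*} [RCLike 𝕜]
  [NormedAddCommGroup H] [InnerProductSpace 𝕜 H]
  [NormedAddCommGroup K] [InnerProductSpace 𝕜 K]

/-- The null space `N(T)`, as a subspace of `H`. -/
def nullSpace (T : H →ₗ.[𝕜] K) : Submodule 𝕜 H :=
  (LinearMap.ker T.toFun).map T.domain.subtype

/-- The range `R(T)`. -/
def range (T : H →ₗ.[𝕜] K) : Submodule 𝕜 K :=
  LinearMap.range T.toFun

/-- The restriction of `T` to its carrier `C(T) = D(T) ∩ N(T)ᗮ`. -/
def restrictCarrier (T : H →ₗ.[𝕜] K) : H →ₗ.[𝕜] K :=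
  T.domRestrict (nullSpace T)ᗮ

theorem ker_restrictCarrier (T : H →ₗ.[𝕜] K) : (restrictCarrier T).toFun.ker = ⊥ := by
  rw [LinearMap.ker_eq_bot']
  rintro ⟨x, hx, hx'⟩ h
  have h0 : T ⟨x, hx'⟩ = 0 := h
  have hN : x ∈ nullSpace T := ⟨⟨x, hx'⟩, h0, rfl⟩
  exact Subtype.ext ((Submodule.disjoint_def.1 (nullSpace T).orthogonal_disjoint) x hN hx)

theorem disjoint_mp_domains (T : H →ₗ.[𝕜] K) :
    Disjoint (restrictCarrier T).inverse.domain
      ((0 : K →ₗ[𝕜] H).toPMap (range T)ᗮ).domain := by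
  rw [LinearPMap.inverse_domain]
  refine (range T).orthogonal_disjoint.mono_left ?_
  rintro _ ⟨x, rfl⟩
  exact ⟨⟨x, x.2.2⟩, rfl⟩

/-- The Moore-Penrose inverse of `T`: the operator with domain `R(T) ⊕ R(T)ᗮ` that is the inverse
of the restriction of `T` to its carrier on `R(T)`, and zero on `R(T)ᗮ`. (For a closed `T` the
restriction of `T` to its carrier has the same range as `T`.) -/
def moorePenrose (T : H →ₗ.[𝕜] K) : K →ₗ.[𝕜] H :=
  (restrictCarrier T).inverse.sup ((0 : K →ₗ[𝕜] H).toPMap (range T)ᗮ)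
    (LinearPMap.sup_h_of_disjoint _ _ (disjoint_mp_domains T))

theorem mem_graph_moorePenrose (T : H →ₗ.[𝕜] K) (y : K) (x : H) :
    (y, x) ∈ (moorePenrose T).graph ↔
      x ∈ (nullSpace T)ᗮ ∧ ∃ z, (x, z) ∈ T.graph ∧ y - z ∈ (range T)ᗮ := by
  have key : ∀ (a : K) (b : H), (a, b) ∈ (restrictCarrier T).inverse.graph ↔
      b ∈ (nullSpace T)ᗮ ∧ (b, a) ∈ T.graph := by
    intro a b
    rw [LinearPMap.inverse_graph (ker_restrictCarrier T)]
    constructor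
    · rintro ⟨⟨b', a'⟩, h, h'⟩
      obtain ⟨rfl, rfl⟩ := Prod.mk.inj h'
      obtain ⟨u, hu, hu'⟩ := (LinearPMap.mem_graph_iff _).1 h
      simp only at hu hu'
      subst hu hu'
      exact ⟨u.2.1, (LinearPMap.mem_graph_iff _).2 ⟨⟨u, u.2.2⟩, rfl, rfl⟩⟩
    · rintro ⟨h, h'⟩
      obtain ⟨u, hu, hu'⟩ := (LinearPMap.mem_graph_iff _).1 h'
      simp only at hu hu'
      subst hu hu'
      exact ⟨(u, T u), (LinearPMap.mem_graph_iff _).2 ⟨⟨u, h, u.2⟩, rfl, rfl⟩, rfl⟩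
  constructor
  · intro h
    obtain ⟨⟨v, hv⟩, hvy, hvx⟩ := (LinearPMap.mem_graph_iff _).1 h
    obtain ⟨a, ha, b, hb, hab⟩ := Submodule.mem_sup.1 hv
    have e : moorePenrose T ⟨v, hv⟩ = (restrictCarrier T).inverse ⟨a, ha⟩ + 0 :=
      LinearPMap.sup_apply _ ⟨a, ha⟩ ⟨b, hb⟩ ⟨v, hv⟩ hab
    simp only at hvy hvx
    rw [add_zero, hvx] at e
    subst hvy
    have := (key a x).1 ((LinearPMap.mem_graph_iff _).2 ⟨⟨a, ha⟩, rfl, e.symm⟩)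
    refine ⟨this.1, a, this.2, ?_⟩
    rw [← hab, add_sub_cancel_left]
    exact hb
  · rintro ⟨hx, z, hz, hyz⟩
    obtain ⟨⟨a, ha⟩, haz, hax⟩ := (LinearPMap.mem_graph_iff _).1 ((key z x).2 ⟨hx, hz⟩)
    simp only at haz hax
    subst haz
    have hy : y ∈ (moorePenrose T).domain := Submodule.mem_sup.2 ⟨a, ha, y - a, hyz, by abel⟩
    refine (LinearPMap.mem_graph_iff _).2 ⟨⟨y, hy⟩, rfl, ?_⟩
    refine (LinearPMap.sup_apply _ ⟨a, ha⟩ ⟨y - a, hyz⟩ ⟨y, hy⟩ (by simp)).trans ?_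
    rw [hax]
    exact add_zero x

/-- `A` is the non-negative self-adjoint square root of `S`: `A` is self-adjoint (hence densely
defined and closed), `⟨A x, x⟩ ≥ 0` for `x ∈ D(A)`, and `A A = S`, domains included. -/
structure IsNonnegSqrt [CompleteSpace H] (S A : H →ₗ.[𝕜] H) : Prop where
  isSelfAdjoint : IsSelfAdjoint A
  nonneg : ∀ x : A.domain, 0 ≤ RCLike.re (inner 𝕜 (A x) (x : H))
  sq : comp A A = S

open Classical in
/-- The square root `S^{1/2}` of a non-negative self-adjoint operator (which exists and is unique);
the value is `0` if `S` has no non-negative self-adjoint square root. -/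
def sqrt [CompleteSpace H] (S : H →ₗ.[𝕜] H) : H →ₗ.[𝕜] H :=
  if h : ∃ A, IsNonnegSqrt S A then h.choose else 0

/-- The modulus `|T| = (T* T)^{1/2}`. -/
def modulus [CompleteSpace H] (T : H →ₗ.[𝕜] K) : H →ₗ.[𝕜] H :=
  sqrt (comp T.adjoint T)

/-- The generalized Cauchy dual `w(T) = T (T* T)†`, where `†` is the Moore-Penrose inverse. -/
def cauchyDual [CompleteSpace H] (T : H →ₗ.[𝕜] K) : H →ₗ.[𝕜] K :=
  comp T (moorePenrose (comp T.adjoint T))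

end UnboundedOp

end

/-! By the closed graph theorem, `T†` is a bounded everywhere defined operator `G`. Put `B = G G*`,
with positive square root `C`. The key fact, `isPinv_adjoint_comp_self`, is that `T*T` is the
unbounded Moore-Penrose inverse of `B`. Hence `(T*T)† = B = C²`, and all three operators of the
theorem equal `C`: `w(T) = T G G* = G*`, so `w(T)* w(T) = C²` and `|w(T)| = C`; `|T|` is the
unbounded pseudo-inverse of `C`, so `|T|† = C`; `w(|T|) = |T| C² = C`.

Since `sqrt` is an arbitrary choice among non-negative self-adjoint roots, uniqueness is needed for
the roots of `T*T` (`IsNonnegSqrt.isPinv`) and of `C²` (`IsNonnegSqrt.eq_toPMap`), with possibly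
unbounded competitors. Each time Hellinger–Toeplitz produces a bounded positive root of `C²`, which
must be `C`. Bounded roots are built by an iteration that works over `ℝ` and `ℂ` alike. -/

namespace ContinuousLinearMap

/-! ### Square roots of bounded positive operators -/

open Filter Topology

variable {𝕜 E : Type*} [RCLike 𝕜] [NormedAddCommGroup E] [InnerProductSpace 𝕜 E]

/-- A positive contraction `B` satisfies `‖1 - B‖ ≤ 1`. -/
theorem IsPositive.norm_one_sub_le {B : E →L[𝕜] E} (hB : B.IsPositive) (h1 : ‖B‖ ≤ 1) :
    ‖1 - B‖ ≤ 1 := by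
  refine ContinuousLinearMap.opNorm_le_bound _ zero_le_one fun x => ?_
  rw [one_mul]
  -- Positivity at `x - B x`, with `⟨B²x, Bx⟩ ≤ ‖Bx‖²`, gives `‖Bx‖² ≤ ⟨Bx, x⟩`.
  have hpos := hB.re_inner_nonneg_left (x - B x)
  have hx := hB.re_inner_nonneg_left x
  have hsym : inner 𝕜 (B (B x)) x = inner 𝕜 (B x) (B x) := hB.inner_left_eq_inner_right _ _
  have hBB : RCLike.re (inner 𝕜 (B (B x)) (B x)) ≤ ‖B x‖ ^ 2 := by
    refine (re_inner_le_norm _ _).trans ?_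
    have := (B.le_opNorm (B x)).trans (mul_le_of_le_one_left (norm_nonneg _) h1)
    nlinarith [norm_nonneg (B x)]
  have hsq : RCLike.re (inner 𝕜 (B x) (B x)) = ‖B x‖ ^ 2 := (norm_sq_eq_re_inner (𝕜 := 𝕜) _).symm
  rw [map_sub, inner_sub_left, inner_sub_right, inner_sub_right, hsym] at hpos
  simp only [map_sub, hsq] at hpos
  have hn : ‖x - B x‖ ^ 2 = ‖x‖ ^ 2 - 2 * RCLike.re (inner 𝕜 (B x) x) + ‖B x‖ ^ 2 := by
    rw [norm_sub_sq (𝕜 := 𝕜), inner_re_symm]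
  have : ‖x - B x‖ ^ 2 ≤ ‖x‖ ^ 2 := by linarith
  exact le_of_sq_le_sq this (norm_nonneg _)

/-- The iteration `Y ↦ (X + Y²) / 2` converging to `1 - (1 - X)^{1/2}`. -/
noncomputable def sqrtIter {A : Type*} [Ring A] [Module ℝ A] (X : A) : ℕ → A
  | 0 => 0
  | n + 1 => (2⁻¹ : ℝ) • (X + sqrtIter X n * sqrtIter X n)

/-- The scalar sequence at `1` majorizes the norms and the increments of every sequence with `‖X‖ ≤
1`, so convergence reduces to a bounded monotone real sequence. -/
theorem sqrtIter_real_mem (n : ℕ) : sqrtIter (1 : ℝ) n ∈ Set.Icc (0 : ℝ) 1 := by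
  induction n with
  | zero => simp [sqrtIter]
  | succ n ih =>
    obtain ⟨h0, h1⟩ := ih
    simp only [sqrtIter, smul_eq_mul, Set.mem_Icc]
    constructor <;> nlinarith

theorem sqrtIter_real_mono : Monotone (sqrtIter (1 : ℝ)) := by
  refine monotone_nat_of_le_succ fun n => ?_
  simp only [sqrtIter, smul_eq_mul]
  nlinarith [sq_nonneg (1 - sqrtIter (1 : ℝ) n)]

section Banach

variable {A : Type*} [NormedRing A] [NormedAlgebra ℝ A]

theorem commute_sqrtIter {X Z : A} (h : Commute Z X) (n : ℕ) : Commute Z (sqrtIter X n) := by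
  induction n with
  | zero => exact Commute.zero_right _
  | succ n ih => exact (h.add_right (ih.mul_right ih)).smul_right _

theorem norm_sqrtIter_le {X : A} (hX : ‖X‖ ≤ 1) (n : ℕ) :
    ‖sqrtIter X n‖ ≤ sqrtIter (1 : ℝ) n := by
  induction n with
  | zero => simp [sqrtIter]
  | succ n ih =>
    simp only [sqrtIter, norm_smul, smul_eq_mul]
    have h2 : ‖(2⁻¹ : ℝ)‖ = 2⁻¹ := by norm_num
    rw [h2]
    refine mul_le_mul_of_nonneg_left ((norm_add_le _ _).trans (add_le_add hX ?_)) (by norm_num)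
    exact (norm_mul_le _ _).trans (mul_le_mul ih ih (norm_nonneg _) (sqrtIter_real_mem n).1)

/-- The iterates commute, so each increment is half the sum times the difference of the two previous
iterates. The scalar increments factor the same way. -/
theorem norm_sqrtIter_succ_sub_le {X : A} (hX : ‖X‖ ≤ 1) (n : ℕ) :
    ‖sqrtIter X (n + 1) - sqrtIter X n‖ ≤ sqrtIter (1 : ℝ) (n + 1) - sqrtIter (1 : ℝ) n := by
  induction n with
  | zero => simpa [sqrtIter] using norm_sqrtIter_le hX 1
  | succ n ih =>
    have hc : Commute (sqrtIter X n) (sqrtIter X (n + 1)) :=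
      commute_sqrtIter (commute_sqrtIter (Commute.refl X) n).symm _
    have e : sqrtIter X (n + 2) - sqrtIter X (n + 1) =
        (2⁻¹ : ℝ) • ((sqrtIter X (n + 1) + sqrtIter X n) *
          (sqrtIter X (n + 1) - sqrtIter X n)) := by
      rw [← hc.symm.mul_self_sub_mul_self_eq, sqrtIter, sqrtIter.eq_2 X n, ← smul_sub]
      congr 1
      abel
    have e' : sqrtIter (1 : ℝ) (n + 2) - sqrtIter (1 : ℝ) (n + 1) =
        2⁻¹ * ((sqrtIter (1 : ℝ) (n + 1) + sqrtIter (1 : ℝ) n) *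
          (sqrtIter (1 : ℝ) (n + 1) - sqrtIter (1 : ℝ) n)) := by
      rw [sqrtIter, sqrtIter.eq_2 (1 : ℝ) n]
      simp only [smul_eq_mul]
      ring
    rw [e, e', norm_smul]
    have h2 : ‖(2⁻¹ : ℝ)‖ = 2⁻¹ := by norm_num
    rw [h2]
    refine mul_le_mul_of_nonneg_left ((norm_mul_le _ _).trans (mul_le_mul ?_ ih (norm_nonneg _) ?_))
      (by norm_num)
    · exact (norm_add_le _ _).trans (add_le_add (norm_sqrtIter_le hX _) (norm_sqrtIter_le hX _))
    · exact add_nonneg (sqrtIter_real_mem _).1 (sqrtIter_real_mem _).1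

theorem exists_tendsto_sqrtIter [CompleteSpace A] {X : A} (hX : ‖X‖ ≤ 1) :
    ∃ Y, Tendsto (sqrtIter X) atTop (𝓝 Y) := by
  have hs : Summable fun n => sqrtIter (1 : ℝ) (n + 1) - sqrtIter (1 : ℝ) n := by
    refine summable_of_sum_range_le (c := 1)
      (fun n => sub_nonneg.2 (sqrtIter_real_mono n.le_succ)) fun n => ?_
    rw [Finset.sum_range_sub]
    simpa [sqrtIter] using (sqrtIter_real_mem n).2
  refine cauchySeq_tendsto_of_complete (cauchySeq_of_summable_dist ?_)
  refine hs.of_nonneg_of_le (fun _ => dist_nonneg) fun n => ?_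
  rw [dist_comm, dist_eq_norm]
  exact norm_sqrtIter_succ_sub_le hX n

end Banach

variable [CompleteSpace E]

theorem isSelfAdjoint_sqrtIter {A : Type*} [Ring A] [StarRing A] [Module ℝ A]
    [StarModule ℝ A] {X : A} (hX : IsSelfAdjoint X) (n : ℕ) :
    IsSelfAdjoint (sqrtIter X n) := by
  induction n with
  | zero => exact IsSelfAdjoint.zero _
  | succ n ih =>
    refine IsSelfAdjoint.smul (IsSelfAdjoint.all _) (hX.add ?_)
    rw [IsSelfAdjoint, star_mul, ih.star_eq]

/-- Existence of the square root of a positive contraction. -/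
theorem IsPositive.exists_sqrt_of_norm_le_one {B : E →L[𝕜] E} (hB : B.IsPositive)
    (h1 : ‖B‖ ≤ 1) :
    ∃ C : E →L[𝕜] E, C.IsPositive ∧ C * C = B ∧ ∀ D, Commute D B → Commute D C := by
  let : NormedAlgebra ℝ (E →L[𝕜] E) := NormedAlgebra.restrictScalars ℝ 𝕜 _
  have hX := hB.norm_one_sub_le h1
  obtain ⟨Y, hY⟩ := exists_tendsto_sqrtIter hX
  -- The fixed point equation is a rewriting of `(1 - Y)² = B`.
  have hfix : Y = (2⁻¹ : ℝ) • (1 - B + Y * Y) :=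
    tendsto_nhds_unique (hY.comp (tendsto_add_atTop_nat 1))
      (((hY.mul hY).const_add _).const_smul _)
  have hYn : ‖Y‖ ≤ 1 := le_of_tendsto hY.norm <| Eventually.of_forall fun n =>
    (norm_sqrtIter_le hX n).trans (sqrtIter_real_mem n).2
  have hYs : IsSelfAdjoint Y := by
    have hstar : StarModule ℝ (E →L[𝕜] E) := ⟨fun r T => by
      rw [RCLike.real_smul_eq_coe_smul (K := 𝕜) r T,
        RCLike.real_smul_eq_coe_smul (K := 𝕜) _ (star T), star_smul]
      simp⟩
    exact isClosed_eq continuous_star continuous_id |>.mem_of_tendsto hY <|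
      Eventually.of_forall fun n =>
        isSelfAdjoint_sqrtIter ((IsSelfAdjoint.one _).sub hB.isSelfAdjoint) n
  refine ⟨1 - Y, ?_, ?_, fun D hD => ?_⟩
  · rw [isPositive_def']
    refine ⟨(IsSelfAdjoint.one _).sub hYs, fun x => ?_⟩
    have h := (re_inner_le_norm (𝕜 := 𝕜) (Y x) x).trans
      (mul_le_mul_of_nonneg_right (Y.le_of_opNorm_le hYn x) (norm_nonneg x))
    have e : (1 - Y).reApplyInnerSelf x = ‖x‖ * ‖x‖ - RCLike.re (inner 𝕜 (Y x) x) := by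
      rw [reApplyInnerSelf_apply, ← inner_self_eq_norm_mul_norm (𝕜 := 𝕜), sub_apply, one_apply_eq_self,
        inner_sub_left, map_sub]
    rw [e]
    linarith
  · have h2 : (2 : ℝ) • Y = 1 - B + Y * Y := by
      conv_lhs => rw [hfix]
      rw [smul_smul]; norm_num
    replace h2 : Y + Y = 1 - B + Y * Y := (two_smul ℝ Y).symm.trans h2
    have : B = 1 + Y * Y - (Y + Y) := by rw [h2]; abel
    rw [this]; noncomm_ring
  · refine (Commute.one_right D).sub_right ?_
    refine (isClosed_eq (continuous_const.mul continuous_id)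
      (continuous_id.mul continuous_const)).mem_of_tendsto hY <|
        Eventually.of_forall fun n => commute_sqrtIter ((Commute.one_right D).sub_right hD) n

theorem IsPositive.exists_sqrt {B : E →L[𝕜] E} (hB : B.IsPositive) :
    ∃ C : E →L[𝕜] E, C.IsPositive ∧ C * C = B ∧ ∀ D, Commute D B → Commute D C := by
  -- The added `1` keeps `c` invertible when `B = 0`.
  set c : ℝ := ‖B‖ + 1
  have hc : 0 < c := by positivity
  have hn : ‖((c⁻¹ : ℝ) : 𝕜) • B‖ ≤ 1 := by
    rw [norm_smul, RCLike.norm_ofReal, abs_of_pos (inv_pos.2 hc), inv_mul_le_one₀ hc]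
    simp [c]
  obtain ⟨C, hC, hCC, hcomm⟩ := (hB.smul_of_nonneg (c := ((c⁻¹ : ℝ) : 𝕜))
    (RCLike.ofReal_nonneg.2 (inv_pos.2 hc).le)).exists_sqrt_of_norm_le_one hn
  refine ⟨((√c : ℝ) : 𝕜) • C, hC.smul_of_nonneg (RCLike.ofReal_nonneg.2 (Real.sqrt_nonneg c)), ?_,
    fun D hD => (hcomm D (hD.smul_right _)).smul_right _⟩
  rw [smul_mul_smul_comm, hCC, smul_smul, ← RCLike.ofReal_mul, ← RCLike.ofReal_mul,
    Real.mul_self_sqrt hc.le, mul_inv_cancel₀ hc.ne', RCLike.ofReal_one, one_smul]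

/-- For `y = (C - D) x`, commutation gives `(C + D) y = 0`, so the non-negative numbers `⟨Cy, y⟩`
and `⟨Dy, y⟩` both vanish. Square roots of `C` and `D` turn this into `Cy = Dy = 0`, whence `‖y‖² =
⟨x, (C - D) y⟩ = 0`. -/
theorem IsPositive.eq_of_commute_of_sq_eq {C D : E →L[𝕜] E} (hC : C.IsPositive)
    (hD : D.IsPositive) (hcomm : Commute C D) (h : C * C = D * D) : C = D := by
  ext x
  set y := (C - D) x with hy
  have hz : C y + D y = 0 := by
    have : (C + D) * (C - D) = 0 := by rw [← hcomm.mul_self_sub_mul_self_eq, h, sub_self]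
    exact congr($this x)
  have hs : RCLike.re (inner 𝕜 (C y) y) + RCLike.re (inner 𝕜 (D y) y) = 0 := by
    rw [← map_add, ← inner_add_left, hz, inner_zero_left, map_zero]
  have hCD : (C - D).IsSymmetric := hC.isSymmetric.sub hD.isSymmetric
  have key : ∀ P : E →L[𝕜] E, P.IsPositive → RCLike.re (inner 𝕜 (P y) y) = 0 → P y = 0 := by
    intro P hP h0
    obtain ⟨Q, hQ, hQQ, -⟩ := hP.exists_sqrt
    have e : P y = Q (Q y) := by rw [← hQQ]; rfl
    rw [e, hQ.inner_left_eq_inner_right, inner_self_eq_norm_sq, sq_eq_zero_iff, norm_eq_zero] at h0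
    rw [e, h0, map_zero]
  have hCy := key C hC (by linarith [hC.re_inner_nonneg_left y, hD.re_inner_nonneg_left y])
  have hDy := key D hD (by linarith [hC.re_inner_nonneg_left y, hD.re_inner_nonneg_left y])
  have : inner 𝕜 y y = 0 := by
    conv_lhs => rw [hy]
    refine (hCD x y).trans ?_
    simp [hCy, hDy]
  exact sub_eq_zero.1 (inner_self_eq_zero.1 this)

/-- A positive bounded operator has at most one positive square root. -/
theorem IsPositive.eq_of_sq_eq {C D : E →L[𝕜] E} (hC : C.IsPositive) (hD : D.IsPositive)
    (h : C * C = D * D) : C = D := by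
  have hB : (C * C).IsPositive := by
    have := isPositive_self_comp_adjoint C
    rwa [hC.isSelfAdjoint.adjoint_eq] at this
  -- `C` and `D` need not commute with each other, but both commute with `C²` and hence with `Q`.
  obtain ⟨Q, hQ, hQQ, hcomm⟩ := hB.exists_sqrt
  have h1 := hC.eq_of_commute_of_sq_eq hQ
    (hcomm C ((Commute.refl C).mul_right (Commute.refl C))) hQQ.symm
  have h2 := hD.eq_of_commute_of_sq_eq hQ
    (hcomm D (h ▸ (Commute.refl D).mul_right (Commute.refl D))) (h ▸ hQQ.symm)
  rw [h1, h2]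

end ContinuousLinearMap

/-! ### Calculus of operator graphs -/

namespace UnboundedOp

open ContinuousLinearMap

variable {𝕜 H K : Type*} [RCLike 𝕜]
  [NormedAddCommGroup H] [InnerProductSpace 𝕜 H]
  [NormedAddCommGroup K] [InnerProductSpace 𝕜 K]

theorem ext_graph {S T : H →ₗ.[𝕜] K} (h : ∀ x y, (x, y) ∈ S.graph ↔ (x, y) ∈ T.graph) : S = T :=
  LinearPMap.eq_of_eq_graph (SetLike.ext fun p => h p.1 p.2)

theorem mem_graph_toPMap_top (f : H →ₗ[𝕜] K) (x : H) (y : K) :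
    (x, y) ∈ (f.toPMap ⊤).graph ↔ y = f x := by
  rw [LinearPMap.mem_graph_iff]
  constructor
  · rintro ⟨u, hu, hy⟩
    simp only at hu hy
    rw [← hy, ← hu]
    rfl
  · rintro rfl
    exact ⟨⟨x, Submodule.mem_top⟩, rfl, rfl⟩

theorem comp_toPMap_top {L : Type*} [NormedAddCommGroup L] [InnerProductSpace 𝕜 L]
    (g : K →L[𝕜] L) (f : H →L[𝕜] K) :
    comp ((g : K →ₗ[𝕜] L).toPMap ⊤) ((f : H →ₗ[𝕜] K).toPMap ⊤) =
      ((g.comp f : H →L[𝕜] L) : H →ₗ[𝕜] L).toPMap ⊤ := by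
  refine ext_graph fun x y => ?_
  rw [mem_graph_comp, mem_graph_toPMap_top]
  simp only [mem_graph_toPMap_top, exists_eq_left]
  rfl

theorem mem_nullSpace_iff (T : H →ₗ.[𝕜] K) (x : H) : x ∈ nullSpace T ↔ (x, 0) ∈ T.graph := by
  rw [LinearPMap.mem_graph_iff]
  constructor
  · rintro ⟨u, hu, rfl⟩
    exact ⟨u, rfl, hu⟩
  · rintro ⟨u, rfl, hu⟩
    exact ⟨u, hu, rfl⟩

theorem mem_range_iff (T : H →ₗ.[𝕜] K) (y : K) : y ∈ range T ↔ ∃ x, (x, y) ∈ T.graph := by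
  simp only [LinearPMap.mem_graph_iff]
  constructor
  · rintro ⟨u, rfl⟩
    exact ⟨u, u, rfl, rfl⟩
  · rintro ⟨x, u, -, rfl⟩
    exact ⟨u, rfl⟩

theorem sub_mem_graph {T : H →ₗ.[𝕜] K} {x x' : H} {y y' : K} (h : (x, y) ∈ T.graph)
    (h' : (x', y') ∈ T.graph) : (x - x', y - y') ∈ T.graph := T.graph.sub_mem h h'

theorem add_mem_graph {T : H →ₗ.[𝕜] K} {x x' : H} {y y' : K} (h : (x, y) ∈ T.graph)
    (h' : (x', y') ∈ T.graph) : (x + x', y + y') ∈ T.graph := T.graph.add_mem h h'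

theorem mem_graph_adjoint [CompleteSpace H] {T : H →ₗ.[𝕜] K} (hT : Dense (T.domain : Set H))
    (u : K) (v : H) :
    (u, v) ∈ T.adjoint.graph ↔ ∀ x z, (x, z) ∈ T.graph → inner 𝕜 z u = inner 𝕜 x v := by
  rw [LinearPMap.adjoint_graph_eq_graph_adjoint hT, Submodule.mem_adjoint_iff]
  simp only [sub_eq_zero]

/-! ### Unbounded pseudo-inverses of bounded operators, and their square roots -/

section Pinv

/-- `S` is the unbounded Moore-Penrose inverse of the bounded operator `B`, for self-adjoint `B`. -/
def IsPinv (S : H →ₗ.[𝕜] H) (B : H →L[𝕜] H) : Prop :=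
  ∀ x y, (x, y) ∈ S.graph ↔ y ∈ B.kerᗮ ∧ B (x - B y) = 0

variable {S A : H →ₗ.[𝕜] H} {B C : H →L[𝕜] H}

theorem map_mem_ker_orthogonal (hB : B.IsSymmetric) (x : H) : B x ∈ B.kerᗮ := by
  rw [Submodule.mem_orthogonal]
  intro n hn
  have hn : B n = 0 := hn
  exact ((hB n x).symm.trans (by rw [coe_coe, hn, inner_zero_left]))

theorem eq_zero_of_mem_ker_orthogonal {x : H} (hx : x ∈ B.kerᗮ) (h : B x = 0) : x = 0 :=
  Submodule.disjoint_def.1 B.ker.orthogonal_disjoint x h hx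

theorem eq_of_map_eq {x y : H} (hx : x ∈ B.kerᗮ) (hy : y ∈ B.kerᗮ) (h : B x = B y) : x = y :=
  sub_eq_zero.1 (eq_zero_of_mem_ker_orthogonal (Submodule.sub_mem _ hx hy) (by simp [h]))

theorem exists_mem_ker_orthogonal [CompleteSpace H] (B : H →L[𝕜] H) (x : H) :
    ∃ y ∈ B.kerᗮ, B (x - y) = 0 := by
  have : CompleteSpace B.ker := B.isClosed_ker.completeSpace_coe
  obtain ⟨n, hn, y, hy, rfl⟩ := B.ker.exists_add_mem_mem_orthogonal x
  exact ⟨y, hy, by simpa using hn⟩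

theorem IsPinv.mem_nullSpace_iff (h : IsPinv S B) (x : H) : x ∈ nullSpace S ↔ B x = 0 := by
  rw [UnboundedOp.mem_nullSpace_iff, h]
  simp

theorem IsPinv.nullSpace_eq (h : IsPinv S B) : nullSpace S = B.ker :=
  Submodule.ext h.mem_nullSpace_iff

theorem IsPinv.range_eq (h : IsPinv S B) : range S = B.kerᗮ := by
  ext y
  rw [mem_range_iff]
  exact ⟨fun ⟨x, hx⟩ => ((h _ _).1 hx).1, fun hy => ⟨B y, (h _ _).2 ⟨hy, by simp⟩⟩⟩

theorem IsPinv.map_mem_graph (h : IsPinv S B) {y : H} (hy : y ∈ B.kerᗮ) : (B y, y) ∈ S.graph :=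
  (h _ _).2 ⟨hy, by simp⟩

theorem IsPinv.moorePenrose_eq [CompleteSpace H] (h : IsPinv S B) (hB : B.IsSymmetric) :
    moorePenrose S = B.toPMap ⊤ := by
  have : CompleteSpace B.ker := B.isClosed_ker.completeSpace_coe
  refine ext_graph fun y x => ?_
  rw [mem_graph_moorePenrose, mem_graph_toPMap_top, h.nullSpace_eq, h.range_eq,
    Submodule.orthogonal_orthogonal]
  constructor
  · rintro ⟨hx, z, hz, hyz⟩
    obtain ⟨-, hz⟩ := (h _ _).1 hz
    have e : B y = B z := sub_eq_zero.1 (by rw [← map_sub]; exact hyz)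
    rw [map_sub, sub_eq_zero] at hz
    exact (eq_of_map_eq hx (map_mem_ker_orthogonal hB z) hz).trans e.symm
  · rintro rfl
    refine ⟨map_mem_ker_orthogonal hB y, ?_⟩
    obtain ⟨z, hz, hyz⟩ := exists_mem_ker_orthogonal B y
    refine ⟨z, ?_, hyz⟩
    have e : B y = B z := sub_eq_zero.1 (by rw [← map_sub]; exact hyz)
    rw [coe_coe, e]
    exact h.map_mem_graph hz

theorem isPinv_moorePenrose_toPMap [CompleteSpace H] (hC : C.IsSymmetric) :
    IsPinv (moorePenrose (C.toPMap ⊤)) C := by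
  have hn : nullSpace (C.toPMap ⊤) = C.ker := by
    ext x
    rw [mem_nullSpace_iff, mem_graph_toPMap_top]
    exact eq_comm
  have hr : (range (C.toPMap ⊤))ᗮ = C.ker := by
    ext x
    rw [Submodule.mem_orthogonal]
    simp only [mem_range_iff, mem_graph_toPMap_top]
    constructor
    · intro h
      exact inner_self_eq_zero.1 ((hC _ _).symm.trans (h _ ⟨C x, rfl⟩))
    · rintro hx _ ⟨u, rfl⟩
      have hx : C x = 0 := hx
      exact (hC u x).trans (by rw [coe_coe, hx, inner_zero_right])
  intro x y
  rw [mem_graph_moorePenrose, hn, hr]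
  simp only [mem_graph_toPMap_top]
  exact and_congr_right fun _ => ⟨fun ⟨_, hz, hxz⟩ => hz ▸ hxz, fun hxy => ⟨_, rfl, hxy⟩⟩

theorem IsPinv.isSelfAdjoint [CompleteSpace H] (h : IsPinv A C) (hC : C.IsSymmetric) :
    IsSelfAdjoint A := by
  have hdense : Dense (A.domain : Set H) := by
    rw [Submodule.dense_iff_topologicalClosure_eq_top, Submodule.topologicalClosure_eq_top_iff,
      Submodule.eq_bot_iff]
    intro v hv
    rw [Submodule.mem_orthogonal] at hv
    have hgraph : ∀ {x y}, (x, y) ∈ A.graph → inner 𝕜 x v = 0 := fun hxy =>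
      hv _ (LinearPMap.mem_domain_of_mem_graph hxy)
    obtain ⟨w, hw, hvw⟩ := exists_mem_ker_orthogonal C v
    -- The domain contains both `R(C)` and `ker C`. Orthogonality to the first puts `v` in `ker C`,
    -- and orthogonality to the second then makes `v` vanish.
    have hCv : C v = 0 := by
      obtain ⟨z, hz, hwz⟩ := exists_mem_ker_orthogonal C (C v)
      have e : C (C v) = C z := sub_eq_zero.1 (by rw [← map_sub]; exact hwz)
      have hz0 := hgraph (h.map_mem_graph hz)
      rw [← e] at hz0
      exact inner_self_eq_zero.1 ((hC _ _).symm.trans hz0)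
    exact inner_self_eq_zero.1 (hgraph ((UnboundedOp.mem_nullSpace_iff _ _).1
      ((h.mem_nullSpace_iff v).2 hCv)))
  rw [LinearPMap.isSelfAdjoint_def]
  refine ext_graph fun u v => ?_
  have : CompleteSpace C.ker := C.isClosed_ker.completeSpace_coe
  rw [mem_graph_adjoint hdense, h]
  constructor
  · intro huv
    have hv : v ∈ C.kerᗮ := by
      rw [Submodule.mem_orthogonal]
      intro n hn
      rw [← huv n 0 ((UnboundedOp.mem_nullSpace_iff _ _).1 ((h.mem_nullSpace_iff n).2 hn)),
        inner_zero_left]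
    refine ⟨hv, ?_⟩
    change u - C v ∈ C.ker
    rw [← C.ker.orthogonal_orthogonal, Submodule.mem_orthogonal]
    intro y hy
    rw [inner_sub_right, huv _ _ (h.map_mem_graph hy), sub_eq_zero]
    exact hC y v
  · rintro ⟨hv, huv⟩ x y hxy
    obtain ⟨hy, hxy⟩ := (h _ _).1 hxy
    have h1 : inner 𝕜 y (u - C v) = 0 :=
      (Submodule.mem_orthogonal' _ _).1 hy _ huv
    have h2 : inner 𝕜 (x - C y) v = 0 := (Submodule.mem_orthogonal _ _).1 hv _ hxy
    rw [inner_sub_right, sub_eq_zero] at h1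
    rw [inner_sub_left, sub_eq_zero] at h2
    exact h1.trans ((hC y v).symm.trans h2.symm)

theorem ker_sq_eq (hC : C.IsSymmetric) : (C * C).ker = C.ker := by
  ext x
  refine ⟨fun hx => ?_, fun hx => ?_⟩
  · exact eq_zero_of_mem_ker_orthogonal (map_mem_ker_orthogonal hC x) hx
  · have hx : C x = 0 := hx
    change C (C x) = 0
    rw [hx, map_zero]

/-- This supplies existence of the root: pseudo-inversion respects squaring because `C` and `C²`
have the same kernel. -/
theorem IsPinv.isNonnegSqrt [CompleteSpace H] (h : IsPinv A C) (hC : C.IsPositive)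
    (hS : IsPinv S (C * C)) : IsNonnegSqrt S A where
  isSelfAdjoint := h.isSelfAdjoint hC.isSymmetric
  nonneg x := by
    obtain ⟨hy, hxy⟩ := (h _ _).1 (A.mem_graph x)
    have h2 : inner 𝕜 (A x) (x - C (A x)) = 0 := (Submodule.mem_orthogonal' _ _).1 hy _ hxy
    rw [inner_sub_right, sub_eq_zero] at h2
    rw [h2]
    exact hC.re_inner_nonneg_right _
  sq := by
    refine ext_graph fun x z => ?_
    rw [mem_graph_comp, hS, ker_sq_eq hC.isSymmetric]
    have hk : ∀ w, (C * C) w = 0 ↔ C w = 0 := fun w =>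
      SetLike.ext_iff.1 (ker_sq_eq hC.isSymmetric) w
    rw [hk]
    constructor
    · rintro ⟨y, hxy, hyz⟩
      obtain ⟨hy, hxy⟩ := (h _ _).1 hxy
      obtain ⟨hz, hyz⟩ := (h _ _).1 hyz
      rw [map_sub, sub_eq_zero] at hyz
      obtain rfl := eq_of_map_eq hy (map_mem_ker_orthogonal hC.isSymmetric z) hyz
      exact ⟨hz, hxy⟩
    · rintro ⟨hz, hxz⟩
      exact ⟨C z, (h _ _).2 ⟨map_mem_ker_orthogonal hC.isSymmetric z, hxz⟩, h.map_mem_graph hz⟩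

theorem symm_of_isSelfAdjoint [CompleteSpace H] (hA : IsSelfAdjoint A) {x y x' y' : H}
    (h : (x, y) ∈ A.graph) (h' : (x', y') ∈ A.graph) : inner 𝕜 y x' = inner 𝕜 x y' := by
  rw [← LinearPMap.isSelfAdjoint_def.1 hA] at h'
  exact (mem_graph_adjoint hA.dense_domain _ _).1 h' _ _ h

theorem IsNonnegSqrt.re_inner_nonneg [CompleteSpace H] (hA : IsNonnegSqrt S A) {x y : H}
    (h : (x, y) ∈ A.graph) : 0 ≤ RCLike.re (inner 𝕜 y x) := by
  obtain ⟨u, hu, hu'⟩ := (LinearPMap.mem_graph_iff _).1 h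
  simp only at hu hu'
  subst hu hu'
  exact hA.nonneg u

/-- A non-negative self-adjoint square root of the Moore-Penrose inverse of `C²`, with `C`
positive, is the Moore-Penrose inverse of `C`. -/
theorem IsNonnegSqrt.isPinv [CompleteSpace H] (hA : IsNonnegSqrt S A) (hC : C.IsPositive)
    (hS : IsPinv S (C * C)) : IsPinv A C := by
  have hCs := hC.isSymmetric
  have : CompleteSpace C.ker := C.isClosed_ker.completeSpace_coe
  have hSg : ∀ x z, (∃ y, (x, y) ∈ A.graph ∧ (y, z) ∈ A.graph) ↔
      z ∈ C.kerᗮ ∧ C (x - C (C z)) = 0 := fun x z => by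
    rw [← mem_graph_comp, hA.sq, hS, ker_sq_eq hCs]
    exact and_congr_right fun _ => SetLike.ext_iff.1 (ker_sq_eq hCs) (x - C (C z))
  have hnull : ∀ x, (x, 0) ∈ A.graph ↔ C x = 0 := by
    intro x
    constructor
    · intro hx
      simpa using ((hSg x 0).1 ⟨0, hx, A.graph.zero_mem⟩).2
    · intro hx
      obtain ⟨y, hxy, hy0⟩ := (hSg x 0).2 ⟨Submodule.zero_mem _, by simpa using hx⟩
      have hy := symm_of_isSelfAdjoint hA.isSelfAdjoint hxy hy0
      rw [inner_zero_right, inner_self_eq_zero] at hy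
      rwa [hy] at hxy
  have hran : ∀ {x y}, (x, y) ∈ A.graph → y ∈ C.kerᗮ := by
    intro x y hxy
    rw [Submodule.mem_orthogonal']
    intro n hn
    rw [symm_of_isSelfAdjoint hA.isSelfAdjoint hxy ((hnull n).2 hn), inner_zero_right]
  -- Here `p` is the projection of `y` on `(ker C)ᗮ` and `d = A C² y`, so that `A d = p`. The map `y
  -- ↦ d` will be a bounded positive root of `C²`.
  have hex : ∀ y, ∃ d, d ∈ C.kerᗮ ∧ ∃ p ∈ C.kerᗮ, C (y - p) = 0 ∧
      (d, p) ∈ A.graph ∧ (C (C y), d) ∈ A.graph := by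
    intro y
    obtain ⟨p, hp, hyp⟩ := exists_mem_ker_orthogonal C y
    obtain ⟨d, hd, hdp⟩ := (hSg (C (C p)) p).2 ⟨hp, by simp⟩
    have e : C y = C p := sub_eq_zero.1 (by rw [← map_sub]; exact hyp)
    exact ⟨d, hran hd, p, hp, hyp, hdp, by rwa [e]⟩
  choose d hd p hp hyp hdp hBd using hex
  have hperp : ∀ {a}, a ∈ C.kerᗮ → ∀ y, inner 𝕜 a y = inner 𝕜 a (p y) := by
    intro a ha y
    rw [← sub_eq_zero, ← inner_sub_right]
    exact (Submodule.mem_orthogonal' _ _).1 ha _ (hyp y)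
  have hperp' : ∀ {a}, a ∈ C.kerᗮ → ∀ y, inner 𝕜 y a = inner 𝕜 (p y) a := by
    intro a ha y
    rw [← sub_eq_zero, ← inner_sub_left]
    exact (Submodule.mem_orthogonal _ _).1 ha _ (hyp y)
  have huniq : ∀ {x y y'}, (x, y) ∈ A.graph → (x, y') ∈ A.graph → y = y' := fun h h' =>
    A.mem_graph_snd_inj h h' rfl
  let D₀ : H →ₗ[𝕜] H :=
    { toFun := d
      map_add' := fun a b => huniq (hBd (a + b)) (by
        simpa using add_mem_graph (hBd a) (hBd b))
      map_smul' := fun c a => huniq (hBd (c • a)) (by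
        simpa using A.graph.smul_mem c (hBd a)) }
  have hDs : D₀.IsSymmetric := fun a b => by
    change inner 𝕜 (d a) b = inner 𝕜 a (d b)
    rw [hperp (hd a), hperp' (hd b)]
    exact (symm_of_isSelfAdjoint hA.isSelfAdjoint (hdp a) (hdp b)).symm
  -- Hellinger–Toeplitz: a symmetric map defined everywhere is bounded.
  let D : H →L[𝕜] H := ⟨D₀, hDs.continuous⟩
  have hDpos : D.IsPositive := ⟨hDs, fun a => by
    change 0 ≤ RCLike.re (inner 𝕜 (d a) a)
    rw [hperp (hd a), inner_re_symm]
    exact hA.re_inner_nonneg (hdp a)⟩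
  have hsq : D * D = C * C := by
    ext y
    change d (d y) = C (C y)
    have hpd : p (d y) = d y := (eq_of_map_eq (hd y) (hp _)
      (sub_eq_zero.1 (by rw [← map_sub]; exact hyp (d y)))).symm
    have h1 := sub_mem_graph (hdp (d y)) (hBd y)
    rw [hpd, sub_self, hnull, map_sub, sub_eq_zero] at h1
    exact eq_of_map_eq (hd _) (map_mem_ker_orthogonal hCs _) h1
  have hDC : ∀ y, d y = C y := fun y => congr($(hDpos.eq_of_sq_eq hC hsq) y)
  have hCg : ∀ {y}, y ∈ C.kerᗮ → (C y, y) ∈ A.graph := by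
    intro y hy
    have hpy : p y = y := (eq_of_map_eq hy (hp _)
      (sub_eq_zero.1 (by rw [← map_sub]; exact hyp y))).symm
    have := hdp y
    rwa [hpy, hDC] at this
  intro x y
  constructor
  · intro hxy
    refine ⟨hran hxy, ?_⟩
    rw [← hnull]
    simpa using sub_mem_graph hxy (hCg (hran hxy))
  · rintro ⟨hy, hxy⟩
    simpa using add_mem_graph ((hnull _).2 hxy) (hCg hy)

theorem isNonnegSqrt_toPMap [CompleteSpace H] (hC : C.IsPositive) :
    IsNonnegSqrt ((C * C).toPMap ⊤) (C.toPMap ⊤) where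
  isSelfAdjoint := by
    rw [LinearPMap.isSelfAdjoint_def, toPMap_adjoint_eq_adjoint_toPMap_of_dense _ (by simp),
      hC.isSelfAdjoint.adjoint_eq]
  nonneg x := hC.re_inner_nonneg_left x
  sq := comp_toPMap_top C C

/-- As `A A` is defined everywhere, so is `A`. It is then bounded by Hellinger–Toeplitz, and bounded
uniqueness applies. -/
theorem IsNonnegSqrt.eq_toPMap [CompleteSpace H] (hC : C.IsPositive)
    (hA : IsNonnegSqrt ((C * C).toPMap ⊤) A) : A = C.toPMap ⊤ := by
  have hex : ∀ x, ∃ y, (x, y) ∈ A.graph ∧ (y, C (C x)) ∈ A.graph := fun x => by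
    rw [← mem_graph_comp, hA.sq, mem_graph_toPMap_top]
    rfl
  choose d hd hdd using hex
  have huniq : ∀ {x y y'}, (x, y) ∈ A.graph → (x, y') ∈ A.graph → y = y' := fun h h' =>
    A.mem_graph_snd_inj h h' rfl
  let D₀ : H →ₗ[𝕜] H :=
    { toFun := d
      map_add' := fun a b => huniq (hd (a + b)) (add_mem_graph (hd a) (hd b))
      map_smul' := fun c a => huniq (hd (c • a)) (A.graph.smul_mem c (hd a)) }
  have hDs : D₀.IsSymmetric := fun a b => symm_of_isSelfAdjoint hA.isSelfAdjoint (hd a) (hd b)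
  let D : H →L[𝕜] H := ⟨D₀, hDs.continuous⟩
  have hDpos : D.IsPositive := ⟨hDs, fun a => hA.re_inner_nonneg (hd a)⟩
  have hsq : D * D = C * C := ext fun y => huniq (hd (d y)) (hdd y)
  have hDC : ∀ y, d y = C y := fun y => congr($(hDpos.eq_of_sq_eq hC hsq) y)
  refine ext_graph fun x y => ?_
  rw [mem_graph_toPMap_top, coe_coe, ← hDC]
  exact ⟨fun h => huniq h (hd x), fun h => h ▸ hd x⟩

end Pinv

theorem sqrt_spec [CompleteSpace H] {S A : H →ₗ.[𝕜] H} (h : IsNonnegSqrt S A) :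
    IsNonnegSqrt S (sqrt S) := by
  have hex : ∃ A, IsNonnegSqrt S A := ⟨A, h⟩
  rw [sqrt, dif_pos hex]
  exact hex.choose_spec

/-! ### Closed operators with closed range -/

section ClosedRange

theorem isClosed_nullSpace {T : H →ₗ.[𝕜] K} (hclosed : T.IsClosed) :
    IsClosed (nullSpace T : Set H) := by
  have e : (nullSpace T : Set H) = (fun x : H => (x, (0 : K))) ⁻¹' (T.graph : Set (H × K)) := by
    ext x
    exact mem_nullSpace_iff T x
  rw [e]
  exact IsClosed.preimage (by fun_prop) hclosed

/-- The hypothesis `hG` is the graph form of `G = T†`. For `z` in `R(T)` it forces `T G z = z`,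
since the difference lies in `R(T) ∩ R(T)ᗮ`. -/
theorem sub_apply_mem_nullSpace {T : H →ₗ.[𝕜] K} {G : K →L[𝕜] H}
    (hG : ∀ y, G y ∈ (nullSpace T)ᗮ ∧ ∃ z, (G y, z) ∈ T.graph ∧ y - z ∈ (range T)ᗮ) {x : H} {z : K}
    (h : (x, z) ∈ T.graph) : (x - G z, 0) ∈ T.graph := by
  obtain ⟨hN, w, hw, hzw⟩ := hG z
  have e := Submodule.disjoint_def.1 (range T).orthogonal_disjoint _
    (Submodule.sub_mem _ ((mem_range_iff _ _).2 ⟨_, h⟩) ((mem_range_iff _ _).2 ⟨_, hw⟩)) hzw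
  rw [← sub_eq_zero.1 e] at hw
  simpa using sub_mem_graph h hw

variable [CompleteSpace H] [CompleteSpace K]

/-- The Moore-Penrose inverse of a closed operator with closed range is bounded and everywhere
defined. -/
theorem exists_bounded_moorePenrose {T : H →ₗ.[𝕜] K} (hclosed : T.IsClosed)
    (hrange : IsClosed (range T : Set K)) :
    ∃ G : K →L[𝕜] H, ∀ y, G y ∈ (nullSpace T)ᗮ ∧ ∃ z, (G y, z) ∈ T.graph ∧ y - z ∈ (range T)ᗮ := by
  have hN := isClosed_nullSpace hclosed
  have : CompleteSpace (nullSpace T) := hN.completeSpace_coe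
  have : CompleteSpace (range T) := hrange.completeSpace_coe
  have hdom : (moorePenrose T).domain = ⊤ := by
    rw [Submodule.eq_top_iff']
    intro y
    obtain ⟨z, hz, w, hw, rfl⟩ := (range T).exists_add_mem_mem_orthogonal y
    obtain ⟨x, hx⟩ := (mem_range_iff _ _).1 hz
    obtain ⟨n, hn, x', hx', rfl⟩ := (nullSpace T).exists_add_mem_mem_orthogonal x
    refine LinearPMap.mem_domain_of_mem_graph
      ((mem_graph_moorePenrose T (z + w) x').2 ⟨hx', z, ?_, by simpa using hw⟩)
    simpa using sub_mem_graph hx ((mem_nullSpace_iff _ _).1 hn)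
  let g : K →ₗ[𝕜] H := (moorePenrose T).toFun.comp
    (LinearMap.codRestrict _ LinearMap.id fun y => hdom ▸ Submodule.mem_top)
  have hg : ∀ y x, x = g y ↔ x ∈ (nullSpace T)ᗮ ∧ (x, (range T).starProjection y) ∈ T.graph := by
    intro y x
    have h1 : x = g y ↔ (y, x) ∈ (moorePenrose T).graph := by
      have hgy : (y, g y) ∈ (moorePenrose T).graph :=
        LinearPMap.mem_graph _ ⟨y, hdom ▸ Submodule.mem_top⟩
      exact ⟨fun h => h ▸ hgy, fun h => LinearPMap.mem_graph_snd_inj _ h hgy rfl⟩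
    rw [h1, mem_graph_moorePenrose]
    refine and_congr_right fun _ => ⟨?_, fun h => ⟨_, h, Submodule.sub_starProjection_mem_orthogonal y⟩⟩
    rintro ⟨z, hz, hyz⟩
    rwa [Submodule.eq_starProjection_of_mem_of_inner_eq_zero ((mem_range_iff _ _).2 ⟨x, hz⟩)
      ((Submodule.mem_orthogonal' _ _).1 hyz)]
  -- With `P` the projection on `R(T)`, the graph of `g` is cut out by `x ∈ N(T)ᗮ` and `(x, P y) ∈
  -- T.graph`, both closed conditions.
  have hgc : IsClosed (g.graph : Set (K × H)) := by
    have e : (g.graph : Set (K × H)) = (Prod.snd ⁻¹' ((nullSpace T)ᗮ : Set H)) ∩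
        ((fun q : K × H => (q.2, (range T).starProjection q.1)) ⁻¹' (T.graph : Set (H × K))) := by
      ext ⟨y, x⟩
      exact hg y x
    rw [e]
    exact ((nullSpace T).isClosed_orthogonal.preimage continuous_snd).inter
      (IsClosed.preimage (by fun_prop) hclosed)
  refine ⟨ofIsClosedGraph hgc, fun y => ?_⟩
  have h := (hg y (g y)).1 rfl
  exact ⟨h.1, _, h.2, Submodule.sub_starProjection_mem_orthogonal y⟩

variable {T : H →ₗ.[𝕜] K} {G : K →L[𝕜] H}

/-- `G` vanishes on `R(T)ᗮ`, so its adjoint maps into `R(T)ᗮᗮ`, which is `R(T)` by closedness. -/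
theorem adjoint_mem_range (hrange : IsClosed (range T : Set K))
    (hG : ∀ y, G y ∈ (nullSpace T)ᗮ ∧ ∃ z, (G y, z) ∈ T.graph ∧ y - z ∈ (range T)ᗮ) (x : H) :
    G.adjoint x ∈ range T := by
  have : CompleteSpace (range T) := hrange.completeSpace_coe
  rw [← (range T).orthogonal_orthogonal, Submodule.mem_orthogonal]
  intro y hy
  have h0 : G y = 0 := by
    obtain ⟨hN, z, hz, hyz⟩ := hG y
    have hzr := (mem_range_iff _ _).2 ⟨_, hz⟩
    have hzr' : z ∈ (range T)ᗮ := by simpa using Submodule.sub_mem _ hy hyz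
    have hz0 := Submodule.disjoint_def.1 (range T).orthogonal_disjoint z hzr hzr'
    rw [hz0] at hz
    exact Submodule.disjoint_def.1 (nullSpace T).orthogonal_disjoint _
      ((mem_nullSpace_iff _ _).2 hz) hN
  rw [adjoint_inner_right, h0, inner_zero_left]

theorem apply_adjoint_mem_graph (hrange : IsClosed (range T : Set K))
    (hG : ∀ y, G y ∈ (nullSpace T)ᗮ ∧ ∃ z, (G y, z) ∈ T.graph ∧ y - z ∈ (range T)ᗮ) (x : H) :
    (G (G.adjoint x), G.adjoint x) ∈ T.graph := by
  obtain ⟨-, z, hz, hyz⟩ := hG (G.adjoint x)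
  have h := Submodule.disjoint_def.1 (range T).orthogonal_disjoint _
    (Submodule.sub_mem _ (adjoint_mem_range hrange hG x) ((mem_range_iff _ _).2 ⟨_, hz⟩)) hyz
  rwa [← sub_eq_zero.1 h] at hz

theorem ker_mul_adjoint_eq (hdense : Dense (T.domain : Set H))
    (hG : ∀ y, G y ∈ (nullSpace T)ᗮ ∧ ∃ z, (G y, z) ∈ T.graph ∧ y - z ∈ (range T)ᗮ)
    (hclosed : T.IsClosed) : (G.comp G.adjoint).ker = nullSpace T := by
  have : CompleteSpace (nullSpace T) := (isClosed_nullSpace hclosed).completeSpace_coe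
  ext x
  constructor
  · intro hx
    have hx : G (G.adjoint x) = 0 := hx
    have hx0 : G.adjoint x = 0 := by
      rw [← inner_self_eq_zero (𝕜 := 𝕜), adjoint_inner_left, hx, inner_zero_right]
    obtain ⟨n, hn, m, hm, rfl⟩ := (nullSpace T).exists_add_mem_mem_orthogonal x
    -- `m` is orthogonal to the dense domain: split `u = (u - G T u) + G T u`. The first part lies
    -- in `N(T)`; the second is orthogonal to `n + m`, because `G* x = 0`, and to `n`.
    have hm0 : m = 0 := by
      refine hdense.eq_zero_of_inner_right 𝕜 fun u hu => ?_
      have hug := T.mem_graph ⟨u, hu⟩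
      have hun := sub_apply_mem_nullSpace hG hug
      have h1 : inner 𝕜 (u - G (T ⟨u, hu⟩)) m = 0 :=
        (Submodule.mem_orthogonal _ _).1 hm _ ((mem_nullSpace_iff _ _).2 hun)
      have h2 : inner 𝕜 (G (T ⟨u, hu⟩)) (n + m) = 0 := by
        rw [← adjoint_inner_right, hx0, inner_zero_right]
      have h3 : inner 𝕜 (G (T ⟨u, hu⟩)) n = 0 :=
        (Submodule.mem_orthogonal' _ _).1 (hG _).1 _ hn
      rw [inner_add_right, h3, zero_add] at h2
      rw [inner_sub_left, h2, sub_zero] at h1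
      exact h1
    rwa [hm0, add_zero]
  · intro hx
    have hx0 : G.adjoint x = 0 := by
      rw [← inner_self_eq_zero (𝕜 := 𝕜), adjoint_inner_left]
      exact (Submodule.mem_orthogonal _ _).1 (hG _).1 _ hx
    change G (G.adjoint x) = 0
    rw [hx0, map_zero]

theorem isPinv_adjoint_comp_self (hdense : Dense (T.domain : Set H)) (hclosed : T.IsClosed)
    (hrange : IsClosed (range T : Set K))
    (hG : ∀ y, G y ∈ (nullSpace T)ᗮ ∧ ∃ z, (G y, z) ∈ T.graph ∧ y - z ∈ (range T)ᗮ) :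
    IsPinv (comp T.adjoint T) (G.comp G.adjoint) := by
  have : CompleteSpace (range T) := hrange.completeSpace_coe
  have hker := ker_mul_adjoint_eq hdense hG hclosed
  have hkg : ∀ x, (G.comp G.adjoint) x = 0 ↔ (x, 0) ∈ T.graph := fun x =>
    (SetLike.ext_iff.1 hker x).trans (mem_nullSpace_iff T x)
  intro x y
  rw [mem_graph_comp, hker, hkg]
  simp only [mem_graph_adjoint hdense, comp_apply]
  constructor
  · rintro ⟨z, hxz, hzy⟩
    have hy : y ∈ (nullSpace T)ᗮ := by
      rw [Submodule.mem_orthogonal]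
      intro n hn
      rw [← hzy n 0 ((mem_nullSpace_iff _ _).1 hn), inner_zero_left]
    -- `⟨w, G* y⟩ = ⟨G w, y⟩ = ⟨T G w, z⟩ = ⟨w, z⟩`, because `w - T G w` is orthogonal to `z = T x`.
    have e : G.adjoint y = z := by
      refine ext_inner_left 𝕜 fun w => ?_
      obtain ⟨-, v, hv, hwv⟩ := hG w
      rw [adjoint_inner_right, ← hzy _ _ hv, eq_comm, ← sub_eq_zero, ← inner_sub_left]
      exact (Submodule.mem_orthogonal' _ _).1 hwv _ ((mem_range_iff _ _).2 ⟨_, hxz⟩)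
    refine ⟨hy, ?_⟩
    rw [e]
    exact sub_apply_mem_nullSpace hG hxz
  · rintro ⟨hy, hxy⟩
    -- The intermediate value `T x` must be `G* y`, and `T* G* y = y` because `u - G T u ∈ N(T)` is
    -- orthogonal to `y`.
    refine ⟨G.adjoint y, ?_, fun u v huv => ?_⟩
    · simpa using add_mem_graph hxy (apply_adjoint_mem_graph hrange hG y)
    · rw [adjoint_inner_right, eq_comm, ← sub_eq_zero, ← inner_sub_left]
      exact (Submodule.mem_orthogonal _ _).1 hy _
        ((mem_nullSpace_iff _ _).2 (sub_apply_mem_nullSpace hG huv))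

end ClosedRange

end UnboundedOp

/-- For a densely defined closed operator `T` with closed range, `|w(T)| = w(|T|) = |T|†`. The first
two conjuncts record that both moduli are genuine non-negative self-adjoint square roots. -/
theorem corollary2p9 {𝕜 H K : Type*} [RCLike 𝕜]
    [NormedAddCommGroup H] [InnerProductSpace 𝕜 H] [CompleteSpace H]
    [NormedAddCommGroup K] [InnerProductSpace 𝕜 K] [CompleteSpace K]
    (T : H →ₗ.[𝕜] K) (hdense : Dense (T.domain : Set H)) (hclosed : T.IsClosed)
    (hrange : IsClosed (UnboundedOp.range T : Set K)) :
    UnboundedOp.IsNonnegSqrt (UnboundedOp.comp T.adjoint T) (UnboundedOp.modulus T) ∧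
    UnboundedOp.IsNonnegSqrt
      (UnboundedOp.comp (UnboundedOp.cauchyDual T).adjoint (UnboundedOp.cauchyDual T))
      (UnboundedOp.modulus (UnboundedOp.cauchyDual T)) ∧
    UnboundedOp.modulus (UnboundedOp.cauchyDual T) =
      UnboundedOp.cauchyDual (UnboundedOp.modulus T) ∧
    UnboundedOp.cauchyDual (UnboundedOp.modulus T) =
      UnboundedOp.moorePenrose (UnboundedOp.modulus T) := by

  obtain ⟨G, hG⟩ := UnboundedOp.exists_bounded_moorePenrose hclosed hrange
  have hB : (G.comp G.adjoint).IsPositive := ContinuousLinearMap.isPositive_self_comp_adjoint G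
  obtain ⟨C, hC, hCC, -⟩ := hB.exists_sqrt
  have hS := UnboundedOp.isPinv_adjoint_comp_self hdense hclosed hrange hG
  have hmod : UnboundedOp.IsNonnegSqrt (UnboundedOp.comp T.adjoint T) (UnboundedOp.modulus T) :=
    UnboundedOp.sqrt_spec ((UnboundedOp.isPinv_moorePenrose_toPMap hC.isSymmetric).isNonnegSqrt hC
      (hCC ▸ hS))
  have hA : UnboundedOp.IsPinv (UnboundedOp.modulus T) C := hmod.isPinv hC (hCC ▸ hS)
  have hmp := hS.moorePenrose_eq hB.isSymmetric
  have hw : UnboundedOp.cauchyDual T = G.adjoint.toPMap ⊤ := by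
    refine UnboundedOp.ext_graph fun y x => ?_
    rw [UnboundedOp.cauchyDual, hmp, UnboundedOp.mem_graph_comp, UnboundedOp.mem_graph_toPMap_top]
    simp only [UnboundedOp.mem_graph_toPMap_top, exists_eq_left]
    have h := UnboundedOp.apply_adjoint_mem_graph hrange hG y
    exact ⟨fun h' => T.mem_graph_snd_inj h' h rfl, fun h' => h' ▸ h⟩
  have hww : UnboundedOp.comp (UnboundedOp.cauchyDual T).adjoint (UnboundedOp.cauchyDual T) =
      (C * C).toPMap ⊤ := by
    rw [hw, ContinuousLinearMap.toPMap_adjoint_eq_adjoint_toPMap_of_dense _ (by simp), hCC,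
      ContinuousLinearMap.adjoint_adjoint, UnboundedOp.comp_toPMap_top]
  have hwmod : UnboundedOp.IsNonnegSqrt
      (UnboundedOp.comp (UnboundedOp.cauchyDual T).adjoint (UnboundedOp.cauchyDual T))
      (UnboundedOp.modulus (UnboundedOp.cauchyDual T)) :=
    UnboundedOp.sqrt_spec (A := C.toPMap ⊤) (hww ▸ UnboundedOp.isNonnegSqrt_toPMap hC)
  have h1 : UnboundedOp.modulus (UnboundedOp.cauchyDual T) = C.toPMap ⊤ :=
    UnboundedOp.IsNonnegSqrt.eq_toPMap hC (hww ▸ hwmod)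
  have h2 : UnboundedOp.moorePenrose (UnboundedOp.modulus T) = C.toPMap ⊤ :=
    hA.moorePenrose_eq hC.isSymmetric
  have h3 : UnboundedOp.cauchyDual (UnboundedOp.modulus T) = C.toPMap ⊤ := by
    refine UnboundedOp.ext_graph fun y x => ?_
    -- Since `|T|* |T| = T*T`, its Moore-Penrose inverse is already known to be `C²`; then `|T|`
    -- undoes one factor `C`.
    rw [UnboundedOp.cauchyDual, LinearPMap.isSelfAdjoint_def.1 hmod.isSelfAdjoint, hmod.sq, hmp,
      ← hCC, UnboundedOp.mem_graph_comp, UnboundedOp.mem_graph_toPMap_top]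
    simp only [UnboundedOp.mem_graph_toPMap_top, exists_eq_left]
    have h : (C (C y), C y) ∈ (UnboundedOp.modulus T).graph :=
      hA.map_mem_graph (UnboundedOp.map_mem_ker_orthogonal hC.isSymmetric y)
    exact ⟨fun h' => LinearPMap.mem_graph_snd_inj _ h' h rfl, fun h' => h' ▸ h⟩
  exact ⟨hmod, hwmod, h1.trans h3.symm, h3.trans h2.symm⟩
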